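/- **Setting.** A secondary base station at the origin of $\mathbb R^2$ serves $M\ge 1$ secondary users, independently and uniformly distributed in the disc of radius $R_D>0$ around the origin. Primary transmitters and primary receivers form homogeneous Poisson point processes $\Phi_b,\Phi_\ell$ in $\mathbb R^2$ of densities $\lambda_b,\lambda_\ell>0$. Let $\alpha>2$, $\delta=2/\alpha$, $L(d)=1/(1+d^\alpha)$. The unordered channel gain of a secondary user at distance $d$ from the base station is $|\hat h|^2L(d)$, the gain from the base station to a primary receiver at distance $d_\ell$ is $|g_\ell|^2=|\hat g_\ell|^2L(d_\ell)$, with all small-scale coefficients $\mathcal{CN}(0,1)$; all positions, point processes and coefficients are independent. Let $|h_1|^2\le\dots\le|h_M|^2$ be the ordered user gains. The $m$-th ordered user suffers the interference $I_B=\sum_b L(d_b)$ of the primary transmitters at distance $d_b\ge d_0$ from it (guard zone, $d_0\ge1$). With SNRs $\rho_s,\rho_b,\rho_p$ put $\gamma_t=\min\{\rho_p/\max_{\ell}|g_\ell|^2,\rho_s\}$ and, for power coefficients $a_1\ge\dots\ge a_M\ge0$, $\sum_i a_i=1$, $$\gamma_{m,j}=\frac{|h_m|^2\gamma_t a_j}{|h_m|^2\gamma_t\sum_{i>j}a_i+\rho_bI_B+1},\qquad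 j\le m .$$ For target rates $R_j>0$ let $\tau_j=2^{R_j}-1$. The $m$-th ordered user is in outage if $\gamma_{m,j}<\tau_j$ for some $j\le m$; $P_m$ is the probability of this event. Assume $a_j-\tau_j\sum_{i>j}a_i>0$ for $j\le m$, let $\varepsilon_j=\tau_j/(a_j-\tau_j\sum_{i>j}a_i)$ and $\varepsilon=\max_{j\le m}\varepsilon_j$. Let $\nu,\kappa>0$ and, throughout, $\rho_b=\nu\rho_s$, $\rho_p=\kappa\rho_s$. **Closed forms.** For accuracy parameters $N,K,L\ge1$ let $x^{(n)}_i=\cos\frac{(2i-1)\pi}{2n}$, $w^{(n)}_i=\frac{\pi}{n}\sqrt{1-(x^{(n)}_i)^2}$, $u^{(n)}_i=\frac12(x^{(n)}_i+1)$. For $1\le n\le N$ let $b_n=-\frac12 w^{(N)}_n(x^{(N)}_n+1)$ and $c_n=1+\big(\tfrac{R_D}{2}(x^{(N)}_n+1)\big)^\alpha$; let $b_0=-\sum_{n=1}^Nb_n$, $c_0=0$; let $s_k=u^{(K)}_k$, $t_l=u^{(L)}_l$, $\beta_l=\frac12d_0^{2-\alpha}w^{(L)}_l t_l^{-\delta}$,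 and $$\Lambda(s)=\lambda_b\pi\Big(\big(e^{-sd_0^{-\alpha}}-1\big)d_0^2+s\sum_{l=1}^L\beta_le^{-t_lsd_0^{-\alpha}}\Big).$$ For a function $G$ let $$\mathcal S_m[G]=\frac{M!}{(M-m)!\,(m-1)!}\sum_{r=0}^{M-m}\binom{M-m}{r}\frac{(-1)^r}{m+r}\sum_{q_0+\dots+q_N=m+r}\binom{m+r}{q_0,\dots,q_N}\Big(\prod_{n=0}^Nb_n^{q_n}\Big)G\Big(\sum_{n=0}^Nq_nc_n\Big).$$ With $a_\ell=\delta\pi\lambda_\ell\Gamma(\delta)/\rho_p^\delta$ and $\eta_k=\frac12w^{(K)}_k\big(\frac{\rho_p}{\rho_ss_k}+\delta\big)a_\ell\rho_s^\delta s_k^{\delta-1}e^{-a_\ell\rho_s^\delta s_k^\delta e^{-\rho_p/(\rho_ss_k)}}$, the closed-form outage expression is $$\widetilde P_m(\rho_s)=\mathcal S_m\Big[S\mapsto e^{-a_\ell\rho_s^\delta e^{-\rho_p/\rho_s}-\frac{\varepsilon S}{\rho_s}-\Lambda\left(\frac{\rho_b\varepsilon S}{\rho_s}\right)}+\sum_{k=1}^K\eta_k\,e^{-\frac{\rho_p+\varepsilon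 S}{\rho_ss_k}-\Lambda\left(\frac{\rho_b\varepsilon S}{\rho_ss_k}\right)}\Big].$$ **Claim.** For every $m\in\{1,\dots,M\}$: 1. For all $\rho_s>0$, $P_m=\Pr\{X_m<\varepsilon\}$ with $X_m=|h_m|^2\gamma_t/(\rho_bI_B+1)$. 2. As $\rho_s\to\infty$, $P_m$ tends to a positive constant independent of $\rho_s$, namely to $$\Pr\Big\{|h_m|^2\min\big\{\kappa/\max_\ell|g_\ell|^2,\,1\big\}\le\nu\,\varepsilon\,I_B\Big\}>0 .$$ Consequently there is an error floor, and the diversity order is zero: $-\lim_{\rho_s\to\infty}\log P_m/\log\rho_s=0$. 3. For all $N,K,L\ge1$, the closed-form expression satisfies $$\lim_{\rho_s\to\infty}\widetilde P_m(\rho_s)=\mathcal S_m\Big[S\mapsto e^{-a_\ell^\infty e^{-\kappa}-\Lambda(\nu\varepsilon S)}+\sum_{k=1}^K\eta_k^\infty e^{-\frac{\kappa}{s_k}-\Lambda\left(\frac{\nu\varepsilon S}{s_k}\right)}\Big],$$ where $a_\ell^\infty=\delta\pi\lambda_\ell\Gamma(\delta)/\kappa^\delta$ and $\eta_k^\infty=\frac12w^{(K)}_k\big(\frac{\kappa}{s_k}+\delta\big)a_\ell^\infty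 s_k^{\delta-1}e^{-a_\ell^\infty s_k^\delta e^{-\kappa/s_k}}$; this is a constant independent of $\rho_s$, and whenever it is positive, $-\lim_{\rho_s\to\infty}\log\widetilde P_m/\log\rho_s=0$. -/

import Mathlib

open MeasureTheory ProbabilityTheory Filter Topology
open scoped ENNReal

noncomputable section

namespace CRNoma

/-- The Euclidean plane. -/
abbrev Plane : Type := EuclideanSpace ℝ (Fin 2)

/-- The circularly symmetric complex Gaussian law `CN(0,1)`, with density `exp (-|z|^2) / π`. -/
def stdComplexGaussian : Measure ℂ :=
  volume.withDensity fun z => ENNReal.ofReal (Real.exp (-‖z‖ ^ 2) / Real.pi)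

/-- The points `X 0, X 1, ...` (counted with multiplicity) form a homogeneous Poisson point
process of density `lam > 0` on the plane: the numbers of points in finitely many pairwise disjoint
bounded Borel sets are independent, and the number of points in `A` is Poisson distributed with
mean `lam * area A`. (For `lam > 0` such a process has almost surely infinitely many points, so it
can be enumerated by `ℕ`.) -/
structure IsPoissonProcess {Ω : Type*} [MeasurableSpace Ω] (P : Measure Ω) (lam : ℝ)
    (X : ℕ → Ω → Plane) : Prop where
  measurable : ∀ n, Measurable (X n)
  counts : ∀ (r : ℕ) (A : Fin r → Set Plane), (∀ i, MeasurableSet (A i)) →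
    (∀ i, Bornology.IsBounded (A i)) → Pairwise (fun i j => Disjoint (A i) (A j)) →
    ∀ k : Fin r → ℕ,
      P {ω | ∀ i, {n : ℕ | X n ω ∈ A i}.encard = (k i : ℕ∞)} =
        ∏ i, poissonMeasure (lam * (volume (A i)).toReal).toNNReal {k i}

/-- Deterministic parameters of the network with `M` secondary users. Users are indexed by
`Fin M`, so that the `m`-th user is the index `m - 1`. -/
structure Params (M : ℕ) where
  /-- path loss exponent -/
  alpha : ℝ
  /-- density of the primary transmitters -/
  lamB : ℝ
  /-- density of the primary receivers -/
  lamL : ℝ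
  /-- radius of the disc of the secondary users -/
  RD : ℝ
  /-- radius of the guard zone -/
  d0 : ℝ
  /-- power allocation coefficients -/
  a : Fin M → ℝ
  /-- target data rates -/
  R : Fin M → ℝ
  two_lt_alpha : 2 < alpha
  lamB_pos : 0 < lamB
  lamL_pos : 0 < lamL
  RD_pos : 0 < RD
  one_le_d0 : 1 ≤ d0
  a_nonneg : ∀ j, 0 ≤ a j
  a_antitone : Antitone a
  a_sum : ∑ j, a j = 1
  R_pos : ∀ j, 0 < R j

/-- The independent sources of randomness of the network. -/
inductive Source (M : ℕ) : Type
  | userPos (i : Fin M)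
  | userFading (i : Fin M)
  | prFading (n : ℕ)
  | prPoints
  | ptPoints

/-- The random objects of the network: positions and small-scale fading of the (unordered)
secondary users, positions and fading of the primary receivers, positions of the primary
transmitters. The secondary base station is at the origin. -/
structure Network {M : ℕ} (p : Params M) {Ω : Type*} [MeasurableSpace Ω] (P : Measure Ω) where
  userPos : Fin M → Ω → Plane
  userFading : Fin M → Ω → ℂ
  prPos : ℕ → Ω → Plane
  prFading : ℕ → Ω → ℂ
  ptPos : ℕ → Ω → Plane
  measurable_userPos : ∀ i, Measurable (userPos i)
  measurable_userFading : ∀ i, Measurable (userFading i)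
  measurable_prFading : ∀ n, Measurable (prFading n)
  userPos_uniform : ∀ i, pdf.IsUniform (userPos i) (Metric.closedBall 0 p.RD) P volume
  userFading_law : ∀ i, P.map (userFading i) = stdComplexGaussian
  prFading_law : ∀ n, P.map (prFading n) = stdComplexGaussian
  prPos_poisson : IsPoissonProcess P p.lamL prPos
  ptPos_poisson : IsPoissonProcess P p.lamB ptPos
  independent : iIndep (fun s : Source M => match s with
    | .userPos i => MeasurableSpace.comap (userPos i) inferInstance
    | .userFading i => MeasurableSpace.comap (userFading i) inferInstance
    | .prFading n => MeasurableSpace.comap (prFading n) inferInstance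
    | .prPoints => MeasurableSpace.comap (fun ω n => prPos n ω) MeasurableSpace.pi
    | .ptPoints => MeasurableSpace.comap (fun ω n => ptPos n ω) MeasurableSpace.pi) P

/-- Bounded path loss `L(d) = 1 / (1 + d^α)`. -/
def pathLoss (alpha d : ℝ) : ℝ := 1 / (1 + d ^ alpha)

namespace Params

variable {M : ℕ} (p : Params M)

/-- `τ_j = 2^{R_j} - 1`. -/
def tau (j : Fin M) : ℝ := 2 ^ p.R j - 1

/-- `∑_{i > j} a_i`. -/
def tailPower (j : Fin M) : ℝ := ∑ i ∈ Finset.Ioi j, p.a i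

/-- `ε_j = τ_j / (a_j - τ_j ∑_{i > j} a_i)`; for the last user this is `τ_M / a_M`. -/
def eps (j : Fin M) : ℝ := p.tau j / (p.a j - p.tau j * p.tailPower j)

/-- `ε_m^max = max {ε_1, ..., ε_m}`. -/
def epsMax (m : Fin M) : ℝ := (Finset.Iic m).sup' ⟨m, Finset.mem_Iic.2 le_rfl⟩ p.eps

end Params

namespace Network

variable {M : ℕ} {p : Params M} {Ω : Type*} [MeasurableSpace Ω] {P : Measure Ω}
  (net : Network p P)

/-- Unordered channel gain `|ĥ_i|² L(d_i)` of the secondary user `i`. -/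
def userGain (ω : Ω) (i : Fin M) : ℝ :=
  ‖net.userFading i ω‖ ^ 2 * pathLoss p.alpha ‖net.userPos i ω‖

/-- The user which has the `m`-th smallest channel gain. -/
def ordered (m : Fin M) (ω : Ω) : Fin M := Tuple.sort (net.userGain ω) m

/-- Ordered channel gain `|h_m|²`, so that `|h_1|² ≤ ... ≤ |h_M|²`. -/
def gain (m : Fin M) (ω : Ω) : ℝ≥0∞ := ENNReal.ofReal (net.userGain ω (net.ordered m ω))

/-- `max_ℓ |g_ℓ|²`, the largest channel gain from the base station to a primary receiver. -/
def maxPRGain (ω : Ω) : ℝ≥0∞ :=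
  ⨆ n, ENNReal.ofReal (‖net.prFading n ω‖ ^ 2 * pathLoss p.alpha ‖net.prPos n ω‖)

/-- `γ_t = min {ρ_p / max_ℓ |g_ℓ|², ρ_s}`. -/
def gammaT (ρs ρp : ℝ) (ω : Ω) : ℝ≥0∞ :=
  min (ENNReal.ofReal ρp / net.maxPRGain ω) (ENNReal.ofReal ρs)

/-- The interference `I_B = ∑_b L(d_b)` at the `m`-th ordered user, from the primary transmitters
outside of the guard zone of radius `d_0` around that user. -/
def interference (m : Fin M) (ω : Ω) : ℝ≥0∞ :=
  ∑' n, if p.d0 ≤ dist (net.ptPos n ω) (net.userPos (net.ordered m ω) ω) then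
    ENNReal.ofReal (pathLoss p.alpha (dist (net.ptPos n ω) (net.userPos (net.ordered m ω) ω)))
  else 0

/-- The SINR `γ_{m,j}` with which the `m`-th ordered user decodes the message of user `j`. -/
def sinr (ρs ρb ρp : ℝ) (m j : Fin M) (ω : Ω) : ℝ≥0∞ :=
  net.gain m ω * net.gammaT ρs ρp ω * ENNReal.ofReal (p.a j) /
    (net.gain m ω * net.gammaT ρs ρp ω * ENNReal.ofReal (p.tailPower j) +
      ENNReal.ofReal ρb * net.interference m ω + 1)

/-- `X_m = |h_m|² γ_t / (ρ_b I_B + 1)`. -/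
def X (ρs ρb ρp : ℝ) (m : Fin M) (ω : Ω) : ℝ≥0∞ :=
  net.gain m ω * net.gammaT ρs ρp ω / (ENNReal.ofReal ρb * net.interference m ω + 1)

/-- Outage probability of the `m`-th ordered user: the probability that, for some `j ≤ m`, the
rate `log₂ (1 + γ_{m,j})` is below the target `R_j`, i.e. `γ_{m,j} < τ_j`. -/
def outageProb (ρs ρb ρp : ℝ) (m : Fin M) : ℝ :=
  P.real {ω | ∃ j ≤ m, net.sinr ρs ρb ρp m j ω < ENNReal.ofReal (p.tau j)}

/-- The probability that `|h_m|² min {κ / max_ℓ |g_ℓ|², 1} ≤ ν ε_m^max I_B`. -/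
def errorFloor (ν κ : ℝ) (m : Fin M) : ℝ :=
  P.real {ω | net.gain m ω * net.gammaT 1 κ ω ≤
    ENNReal.ofReal (ν * p.epsMax m) * net.interference m ω}

end Network

/-- The Gauss-Chebyshev node `cos ((2n-1)π / (2N))`. -/
def node (N n : ℕ) : ℝ := Real.cos ((2 * (n : ℝ) - 1) / (2 * (N : ℝ)) * Real.pi)

/-- The weight `(π/N) √(1 - x_n²)` at that node. -/
def weight (N n : ℕ) : ℝ := Real.pi / N * Real.sqrt (1 - node N n ^ 2)

/-- The node `(x_n + 1) / 2` moved to the interval `(0,1)`; `s_k` and `t_l`. -/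
def unitNode (N n : ℕ) : ℝ := (node N n + 1) / 2

namespace Params

variable {M : ℕ} (p : Params M)

/-- `δ = 2 / α`. -/
def delta : ℝ := 2 / p.alpha

/-- The coefficients `b_n` in `F(y) ≈ ∑_{n=0}^N b_n exp (-c_n y)`, the Gauss-Chebyshev
approximation of the unordered CDF `F(y) = (2/R_D²) ∫_0^{R_D} (1 - exp (-(1+r^α) y)) r dr`. -/
def b (N : ℕ) (n : Fin (N + 1)) : ℝ :=
  if n = 0 then ∑ i ∈ Finset.Icc 1 N, 1 / 2 * weight N i * (node N i + 1)
  else -(1 / 2 * weight N n * (node N n + 1))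

/-- The exponents `c_n` in that approximation; `c_0 = 0`. -/
def c (N : ℕ) (n : Fin (N + 1)) : ℝ :=
  if n = 0 then 0 else 1 + (p.RD / 2 * (node N n + 1)) ^ p.alpha

/-- `β_l`. -/
def beta (L l : ℕ) : ℝ :=
  1 / 2 * p.d0 ^ (2 - p.alpha) * weight L l * unitNode L l ^ (-p.delta)

/-- `λ_b π ((exp (-s d_0^{-α}) - 1) d_0² + s ∑_l β_l exp (-t_l s d_0^{-α}))`, the approximation of
`-log` of the Laplace transform of the interference at `s`. -/
def lapExponent (L : ℕ) (s : ℝ) : ℝ :=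
  p.lamB * Real.pi * ((Real.exp (-(s * p.d0 ^ (-p.alpha))) - 1) * p.d0 ^ 2 +
    s * ∑ l ∈ Finset.Icc 1 L, p.beta L l * Real.exp (-(unitNode L l * s * p.d0 ^ (-p.alpha))))

/-- `δ π λ_ℓ Γ(δ) / ρ^δ`, which is `a_ℓ` for `ρ = ρ_p` and `a_ℓ^∞` for `ρ = κ`. -/
def aL (ρ : ℝ) : ℝ := p.delta * Real.pi * p.lamL * Real.Gamma p.delta / ρ ^ p.delta

/-- `η_k`. -/
def eta (K k : ℕ) (ρs ρp : ℝ) : ℝ :=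
  1 / 2 * weight K k * (ρp / (ρs * unitNode K k) + p.delta) * p.aL ρp * ρs ^ p.delta *
    unitNode K k ^ (p.delta - 1) *
    Real.exp (-(p.aL ρp * ρs ^ p.delta * unitNode K k ^ p.delta *
      Real.exp (-(ρp / (ρs * unitNode K k)))))

/-- `η_k^∞`. -/
def etaInf (K k : ℕ) (κ : ℝ) : ℝ :=
  1 / 2 * weight K k * (κ / unitNode K k + p.delta) * p.aL κ * unitNode K k ^ (p.delta - 1) *
    Real.exp (-(p.aL κ * unitNode K k ^ p.delta * Real.exp (-(κ / unitNode K k))))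

/-- For the `m`-th user (index `m - 1` in `Fin M`), the combinatorial sum
`ψ_m ∑_{p=0}^{M-m} C(M-m,p) (-1)^p/(m+p) ∑_{q_0+...+q_N=m+p} C(m+p; q_0,...,q_N) (∏ b_n^{q_n}) G(∑ q_n c_n)`
where `ψ_m = M! / ((M-m)! (m-1)!)`. -/
def orderedSum (N : ℕ) (m : Fin M) (G : ℝ → ℝ) : ℝ :=
  (M.factorial : ℝ) / ((M - (m + 1)).factorial * (m : ℕ).factorial) *
    ∑ r ∈ Finset.range (M - (m + 1) + 1),
      ((M - (m + 1)).choose r : ℝ) * ((-1) ^ r / ((m : ℝ) + 1 + r)) *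
        ∑ q ∈ Finset.piAntidiag (Finset.univ : Finset (Fin (N + 1))) ((m : ℕ) + 1 + r),
          (Nat.multinomial Finset.univ q : ℝ) * (∏ n, b N n ^ q n) * G (∑ n, (q n : ℝ) * p.c N n)

/-- The closed-form expression of the outage probability of the `m`-th user, with accuracy
parameters `N`, `K`, `L`. -/
def outageClosed (N K L : ℕ) (ρs ρb ρp : ℝ) (m : Fin M) : ℝ :=
  p.orderedSum N m fun S =>
    Real.exp (-(p.aL ρp * ρs ^ p.delta * Real.exp (-(ρp / ρs))) - p.epsMax m * S / ρs
      - p.lapExponent L (ρb * p.epsMax m * S / ρs)) +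
    ∑ k ∈ Finset.Icc 1 K, p.eta K k ρs ρp *
      Real.exp (-((ρp + p.epsMax m * S) / (ρs * unitNode K k))
        - p.lapExponent L (ρb * p.epsMax m * S / (ρs * unitNode K k)))

/-- The closed-form expression of the asymptotic outage probability `P_{m_P}^∞`. -/
def floorClosed (N K L : ℕ) (ν κ : ℝ) (m : Fin M) : ℝ :=
  p.orderedSum N m fun S =>
    Real.exp (-(p.aL κ * Real.exp (-κ)) - p.lapExponent L (ν * p.epsMax m * S)) +
    ∑ k ∈ Finset.Icc 1 K, p.etaInf K k κ *
      Real.exp (-(κ / unitNode K k) - p.lapExponent L (ν * p.epsMax m * S / unitNode K k))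

end Params

end CRNoma

end

namespace CRNoma

/-! ### Algebra in `ℝ≥0∞` -/

/-! No distribution has to be computed. With `ρb = ν ρ` and `ρp = κ ρ` the transmit power is `ρ`
times its value at SNR 1 (`gammaT_scale`), so `ρ` cancels from the outage event except in the noise:
the event reads `g γ < ν ε I + ε / ρ` (`scaled_div_lt_iff`). These events shrink, as `ρ` grows, to
`g γ ≤ ν ε I`, and continuity of measure from above gives the limit. The floor is positive because,
with positive probability, all user fadings are small while some primary transmitter lies in a fixed
ball just outside every guard zone (`measure_small_fading_inter_hits_pos`). The closed form is a
finite sum in which the same scaling leaves only terms in `ε S / ρ`, which vanish. A positive limit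
forces diversity order zero. -/

lemma sinr_lt_iff {y D : ℝ≥0∞} (hy : y ≠ ∞) (hD : 1 ≤ D) {a t τ : ℝ} (ht : 0 ≤ t)
    (hτ : 0 < τ) (h : 0 < a - τ * t) :
    y * ENNReal.ofReal a / (y * ENNReal.ofReal t + D) < ENNReal.ofReal τ ↔
      y / D < ENNReal.ofReal (τ / (a - τ * t)) := by
  have hD0 : D ≠ 0 := (zero_lt_one.trans_le hD).ne'
  rw [ENNReal.div_lt_iff (.inl (by simp [hD0])) (.inr (ENNReal.mul_ne_top hy ENNReal.ofReal_ne_top)),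
    ENNReal.div_lt_iff (.inl hD0) (.inr hy)]
  have hε : 0 < τ / (a - τ * t) := div_pos hτ h
  obtain rfl | hDt := eq_or_ne D ∞
  -- Infinite interference: both inequalities hold, since `y` is finite and `τ`, `ε` are positive.
  · simp [hτ, hε, ENNReal.mul_top, hy.lt_top, ENNReal.mul_lt_top]
  lift y to NNReal using hy
  lift D to NNReal using hDt
  have hD1 : (1 : ℝ) ≤ D := by exact_mod_cast hD
  rw [← ENNReal.ofReal_coe_nnreal, ← ENNReal.ofReal_coe_nnreal (p := D),
    ← ENNReal.ofReal_mul y.coe_nonneg,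
    ← ENNReal.ofReal_mul y.coe_nonneg, ← ENNReal.ofReal_add (by positivity)
    D.coe_nonneg, ← ENNReal.ofReal_mul hτ.le, ← ENNReal.ofReal_mul hε.le,
    ENNReal.ofReal_lt_ofReal_iff (by positivity), ENNReal.ofReal_lt_ofReal_iff (by positivity),
    div_mul_eq_mul_div, lt_div_iff₀ h]
  constructor <;> intro h' <;> linarith

lemma scaled_div_lt_iff {g γ I : ℝ≥0∞} (hg : g ≠ ∞) (hγ : γ ≠ ∞) {ρ ν ε : ℝ} (hρ : 0 < ρ)
    (hε : 0 < ε) :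
    g * (ENNReal.ofReal ρ * γ) / (ENNReal.ofReal (ν * ρ) * I + 1) < ENNReal.ofReal ε ↔
      g * γ < ENNReal.ofReal (ν * ε) * I + ENNReal.ofReal (ε / ρ) := by
  have hρ0 : ENNReal.ofReal ρ ≠ 0 := by simpa using hρ
  rw [ENNReal.div_lt_iff (.inl (by simp))
    (.inr (ENNReal.mul_ne_top hg (ENNReal.mul_ne_top ENNReal.ofReal_ne_top hγ))),
    ← ENNReal.mul_lt_mul_iff_right hρ0 ENNReal.ofReal_ne_top (b := g * γ)]
  have h1 : ENNReal.ofReal ε * (ENNReal.ofReal (ν * ρ) * I + 1) =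
      ENNReal.ofReal ρ * (ENNReal.ofReal (ν * ε) * I + ENNReal.ofReal (ε / ρ)) := by
    rw [mul_add, mul_add, ← mul_assoc, ← mul_assoc, ← ENNReal.ofReal_mul hε.le,
      ← ENNReal.ofReal_mul hρ.le, ← ENNReal.ofReal_mul hρ.le, mul_one, mul_div_cancel₀ _ hρ.ne']
    congr 3
    ring
  rw [h1, mul_left_comm]

/-! ### Positivity of the parameters -/

namespace Params

variable {M : ℕ} (p : Params M)

lemma tau_pos (j : Fin M) : 0 < p.tau j :=
  sub_pos.2 (Real.one_lt_rpow one_lt_two (p.R_pos j))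

lemma tailPower_nonneg (j : Fin M) : 0 ≤ p.tailPower j :=
  Finset.sum_nonneg fun i _ => p.a_nonneg i

lemma epsMax_pos {m : Fin M} (hm : ∀ j ≤ m, 0 < p.a j - p.tau j * p.tailPower j) :
    0 < p.epsMax m :=
  (div_pos (p.tau_pos m) (hm m le_rfl)).trans_le
    (Finset.le_sup' p.eps (Finset.mem_Iic.2 le_rfl))

/-- Attainment of the finite maximum merges the outage events for `j ≤ m` into one threshold. -/
lemma lt_epsMax_iff {m : Fin M} {x : ℝ≥0∞} :
    x < ENNReal.ofReal (p.epsMax m) ↔ ∃ j ≤ m, x < ENNReal.ofReal (p.eps j) := by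
  obtain ⟨i, hi, hi'⟩ := Finset.exists_mem_eq_sup' (s := Finset.Iic m) ⟨m, Finset.mem_Iic.2 le_rfl⟩
    p.eps
  constructor
  · intro h
    exact ⟨i, Finset.mem_Iic.1 hi, by rwa [← hi']⟩
  · rintro ⟨j, hj, h⟩
    exact h.trans_le (ENNReal.ofReal_le_ofReal (Finset.le_sup' p.eps (Finset.mem_Iic.2 hj)))

end Params

/-! ### Path loss, and positive probability of balls -/

lemma pathLoss_pos (α : ℝ) {d : ℝ} (hd : 0 ≤ d) : 0 < pathLoss α d := by
  unfold pathLoss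
  positivity

lemma pathLoss_le_one (α : ℝ) {d : ℝ} (hd : 0 ≤ d) : pathLoss α d ≤ 1 := by
  unfold pathLoss
  have := Real.rpow_nonneg hd α
  rw [div_le_one (by positivity)]
  linarith

lemma pathLoss_anti {α d e : ℝ} (hα : 0 ≤ α) (hd : 0 ≤ d) (h : d ≤ e) :
    pathLoss α e ≤ pathLoss α d := by
  unfold pathLoss
  have := Real.rpow_nonneg hd α
  have := Real.rpow_le_rpow hd h hα
  gcongr

lemma measurable_pathLoss (α : ℝ) : Measurable (pathLoss α) := by
  unfold pathLoss
  fun_prop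

/-- The density vanishes nowhere, so null sets are Lebesgue null. -/
lemma stdComplexGaussian_ball_pos {r : ℝ} (hr : 0 < r) :
    0 < stdComplexGaussian (Metric.ball 0 r) := by
  rw [stdComplexGaussian, pos_iff_ne_zero]
  intro h
  rw [withDensity_apply_eq_zero (by fun_prop)] at h
  have : {z : ℂ | ENNReal.ofReal (Real.exp (-‖z‖ ^ 2) / Real.pi) ≠ 0} = Set.univ := by
    ext z
    simp only [ne_eq, ENNReal.ofReal_eq_zero, not_le, Set.mem_ofPred_eq, Set.mem_univ, iff_true]
    positivity
  rw [this, Set.univ_inter] at h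
  exact (Metric.measure_ball_pos volume (0 : ℂ) hr).ne' h

/-- Already the event of exactly one point in the ball has positive Poisson mass, because the mean
is positive. -/
lemma IsPoissonProcess.measure_hits_pos {Ω : Type*} [MeasurableSpace Ω] {P : Measure Ω} {lam : ℝ}
    {X : ℕ → Ω → Plane} (hX : IsPoissonProcess P lam X) (hlam : 0 < lam) (x : Plane) {r : ℝ}
    (hr : 0 < r) : 0 < P {ω | ∃ n, X n ω ∈ Metric.ball x r} := by
  have h := hX.counts 1 (fun _ => Metric.ball x r) (fun _ => measurableSet_ball)
    (fun _ => Metric.isBounded_ball) (fun i j hij => absurd (Subsingleton.elim i j) hij) (fun _ => 1)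
  have hv : 0 < (volume (Metric.ball x r)).toReal :=
    ENNReal.toReal_pos (Metric.measure_ball_pos volume x hr).ne' measure_ball_lt_top.ne
  have hpos : 0 < (lam * (volume (Metric.ball x r)).toReal).toNNReal :=
    Real.toNNReal_pos.2 (mul_pos hlam hv)
  have h1 : 0 < P {ω | ∀ i : Fin 1, {n : ℕ | X n ω ∈ Metric.ball x r}.encard = ((1 : ℕ) : ℕ∞)} := by
    rw [h, Finset.prod_const, Finset.card_univ, Fintype.card_fin, pow_one, poissonMeasure_singleton]
    have := NNReal.coe_pos.2 hpos
    exact ENNReal.ofReal_pos.2 (by positivity)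
  refine h1.trans_le (measure_mono fun ω hω => ?_)
  have h2 : {n : ℕ | X n ω ∈ Metric.ball x r}.encard = 1 := by simpa using hω 0
  obtain ⟨n, hn⟩ := Set.encard_eq_one.1 h2
  exact ⟨n, (hn ▸ Set.mem_singleton n : n ∈ {n : ℕ | X n ω ∈ Metric.ball x r})⟩

namespace Network

variable {M : ℕ} {p : Params M} {Ω : Type*} [MeasurableSpace Ω] {P : Measure Ω}
  (net : Network p P)

/-! ### Measurability -/

lemma measurable_userGain (i : Fin M) : Measurable fun ω => net.userGain ω i := by
  unfold userGain
  have := measurable_pathLoss p.alpha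
  have := net.measurable_userPos i
  have := net.measurable_userFading i
  fun_prop

/-- There are finitely many sorting permutations, and each is characterised by finitely many
comparisons of gains, with ties broken by index. -/
lemma measurable_ordered (m : Fin M) : Measurable (net.ordered m) := by
  have hsort (σ : Equiv.Perm (Fin M)) : MeasurableSet {ω | σ = Tuple.sort (net.userGain ω)} := by
    simp only [Tuple.eq_sort_iff, Monotone, Function.comp_apply, Set.ofPred_and, Set.ofPred_forall]
    refine .inter (.iInter fun i => .iInter fun j => .iInter fun _ => ?_)
      (.iInter fun i => .iInter fun j => .iInter fun _ => ?_)
    · exact measurableSet_le (net.measurable_userGain _) (net.measurable_userGain _)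
    · exact (measurableSet_eq_fun (net.measurable_userGain _) (net.measurable_userGain _)).imp
        (.const _)
  refine measurable_to_countable' fun i => ?_
  have : net.ordered m ⁻¹' {i} =
      ⋃ σ ∈ {σ : Equiv.Perm (Fin M) | σ m = i}, {ω | σ = Tuple.sort (net.userGain ω)} := by
    ext ω
    simp [ordered]
  rw [this]
  exact .biUnion (Set.to_countable _) fun σ _ => hsort σ

lemma measurable_comp_ordered {β : Type*} [MeasurableSpace β] {f : Ω → Fin M → β}
    (hf : ∀ i, Measurable fun ω => f ω i) (m : Fin M) :
    Measurable fun ω => f ω (net.ordered m ω) :=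
  (measurable_from_prod_countable_left (f := fun x : Ω × Fin M => f x.1 x.2) hf).comp
    (measurable_id.prodMk (net.measurable_ordered m))

lemma measurable_gain (m : Fin M) : Measurable (net.gain m) :=
  (net.measurable_comp_ordered net.measurable_userGain m).ennreal_ofReal

lemma measurable_maxPRGain : Measurable net.maxPRGain := by
  refine .iSup fun n => ?_
  have := measurable_pathLoss p.alpha
  have := net.prPos_poisson.measurable n
  have := net.measurable_prFading n
  fun_prop

lemma measurable_gammaT (ρs ρp : ℝ) : Measurable (net.gammaT ρs ρp) :=
  (measurable_const.div net.measurable_maxPRGain).min measurable_const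

lemma measurable_interference (m : Fin M) : Measurable (net.interference m) := by
  refine .tsum fun n => ?_
  have hd : Measurable fun ω => dist (net.ptPos n ω) (net.userPos (net.ordered m ω) ω) :=
    (net.ptPos_poisson.measurable n).dist
      (net.measurable_comp_ordered (f := fun ω i => net.userPos i ω) net.measurable_userPos m)
  exact .ite (measurableSet_le measurable_const hd)
    ((measurable_pathLoss p.alpha).comp hd).ennreal_ofReal measurable_const

/-! ### Reduction of the outage event -/

lemma gain_ne_top (m : Fin M) (ω : Ω) : net.gain m ω ≠ ∞ := ENNReal.ofReal_ne_top

lemma gammaT_ne_top (ρs ρp : ℝ) (ω : Ω) : net.gammaT ρs ρp ω ≠ ∞ :=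
  ((min_le_right _ _).trans_lt ENNReal.ofReal_lt_top).ne

lemma gammaT_scale {ρ : ℝ} (hρ : 0 < ρ) (κ : ℝ) (ω : Ω) :
    net.gammaT ρ (κ * ρ) ω = ENNReal.ofReal ρ * net.gammaT 1 κ ω := by
  unfold gammaT
  rw [mul_comm κ, ENNReal.ofReal_mul hρ.le, mul_div_assoc, ENNReal.ofReal_one,
    mul_min, mul_one]

lemma exists_sinr_lt_iff (ρs ρb ρp : ℝ) {m : Fin M}
    (hm : ∀ j ≤ m, 0 < p.a j - p.tau j * p.tailPower j) (ω : Ω) :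
    (∃ j ≤ m, net.sinr ρs ρb ρp m j ω < ENNReal.ofReal (p.tau j)) ↔
      net.X ρs ρb ρp m ω < ENNReal.ofReal (p.epsMax m) := by
  rw [p.lt_epsMax_iff]
  refine exists_congr fun j => and_congr_right fun hj => ?_
  unfold sinr
  -- Interference plus noise becomes a single term `D ≥ 1`.
  rw [add_assoc]
  exact sinr_lt_iff (ENNReal.mul_ne_top (net.gain_ne_top m ω) (net.gammaT_ne_top ρs ρp ω))
    le_add_self (p.tailPower_nonneg j) (p.tau_pos j) (hm j hj)

lemma outageProb_eq (ρs ρb ρp : ℝ) {m : Fin M}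
    (hm : ∀ j ≤ m, 0 < p.a j - p.tau j * p.tailPower j) :
    net.outageProb ρs ρb ρp m =
      P.real {ω | net.X ρs ρb ρp m ω < ENNReal.ofReal (p.epsMax m)} := by
  unfold outageProb
  simp only [net.exists_sinr_lt_iff ρs ρb ρp hm]

/-! ### The error floor as a limit -/

lemma tendsto_outageProb [IsProbabilityMeasure P] (ν κ : ℝ) {m : Fin M}
    (hm : ∀ j ≤ m, 0 < p.a j - p.tau j * p.tailPower j) :
    Tendsto (fun ρ : ℝ => net.outageProb ρ (ν * ρ) (κ * ρ) m) atTop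
      (𝓝 (net.errorFloor ν κ m)) := by
  have hε := p.epsMax_pos hm
  -- The parameter `r` stands for `ε / ρ`; intersecting over all `r > 0` turns `<` into `≤`.
  set s : ℝ → Set Ω := fun r => {ω | net.gain m ω * net.gammaT 1 κ ω <
    ENNReal.ofReal (ν * p.epsMax m) * net.interference m ω + ENNReal.ofReal r} with hs
  have hlim : Tendsto (P ∘ s) (𝓝[>] 0) (𝓝 (P (⋂ r > 0, s r))) := by
    refine tendsto_measure_biInter_gt (fun r _ => (measurableSet_lt ?_ ?_).nullMeasurableSet)
      (fun i j _ hij ω hω => ?_) ⟨1, one_pos, measure_ne_top _ _⟩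
    · exact (net.measurable_gain m).mul (net.measurable_gammaT 1 κ)
    · exact ((net.measurable_interference m).const_mul _).add_const _
    · simp only [hs, Set.mem_ofPred_eq] at hω ⊢
      exact hω.trans_le (by gcongr)
  have hInter : ⋂ r > 0, s r = {ω | net.gain m ω * net.gammaT 1 κ ω ≤
      ENNReal.ofReal (ν * p.epsMax m) * net.interference m ω} := by
    ext ω
    simp only [Set.mem_iInter, hs, Set.mem_ofPred_eq]
    constructor
    · intro h
      refine ENNReal.le_of_forall_pos_le_add fun r hr _ => ?_
      simpa using (h r hr).le
    · intro h r hr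
      -- Strictness at infinite interference needs the left side to be finite.
      have hfin : net.gain m ω * net.gammaT 1 κ ω < ∞ :=
        ENNReal.mul_lt_top (net.gain_ne_top m ω).lt_top (net.gammaT_ne_top 1 κ ω).lt_top
      by_cases hI : ENNReal.ofReal (ν * p.epsMax m) * net.interference m ω = ∞
      · simpa [hI] using hfin
      · exact h.trans_lt (ENNReal.lt_add_right hI (by simpa using hr))
  have hdiv : Tendsto (fun ρ : ℝ => p.epsMax m / ρ) atTop (𝓝[>] 0) :=
    tendsto_nhdsWithin_iff.2 ⟨tendsto_const_nhds.div_atTop tendsto_id,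
      (eventually_gt_atTop 0).mono fun ρ hρ => div_pos hε hρ⟩
  rw [hInter] at hlim
  refine ((ENNReal.tendsto_toReal (measure_ne_top _ _)).comp (hlim.comp hdiv)).congr' ?_
  filter_upwards [eventually_gt_atTop 0] with ρ hρ
  rw [net.outageProb_eq _ _ _ hm]
  simp only [X, net.gammaT_scale hρ, scaled_div_lt_iff (net.gain_ne_top m _)
    (net.gammaT_ne_top 1 κ _) hρ hε]
  rfl

/-! ### Positivity of the error floor -/

lemma gain_le {η : ℝ} {ω : Ω} (h : ∀ i, ‖net.userFading i ω‖ ^ 2 ≤ η) (m : Fin M) :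
    net.gain m ω ≤ ENNReal.ofReal η :=
  ENNReal.ofReal_le_ofReal <| (mul_le_of_le_one_right (sq_nonneg _)
    (pathLoss_le_one _ (norm_nonneg _))).trans (h _)

/-- A transmitter within 1 of `x` is at distance at least `d0` and at most `2 RD + d0 + 2` from
every point of the disc, so its single term bounds the sum whichever user is ranked `m`-th. -/
lemma le_interference {ω : Ω} (h : ∀ i, net.userPos i ω ∈ Metric.closedBall 0 p.RD) {x : Plane}
    (hx : ‖x‖ = p.RD + p.d0 + 1) {n : ℕ} (hn : net.ptPos n ω ∈ Metric.ball x 1) (m : Fin M) :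
    ENNReal.ofReal (pathLoss p.alpha (2 * p.RD + p.d0 + 2)) ≤ net.interference m ω := by
  refine le_trans ?_ (ENNReal.le_tsum n)
  have hu := h (net.ordered m ω)
  set u := net.userPos (net.ordered m ω) ω
  set y := net.ptPos n ω
  rw [mem_closedBall_zero_iff] at hu
  rw [Metric.mem_ball] at hn
  have h0 : dist x 0 = p.RD + p.d0 + 1 := by rw [dist_zero_right, hx]
  have hu0 : dist u 0 ≤ p.RD := by rwa [dist_zero_right]
  have h1 : p.d0 ≤ dist y u := by
    linarith [dist_triangle4 x y u 0, dist_comm x y]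
  have h2 : dist y u ≤ 2 * p.RD + p.d0 + 2 := by
    linarith [dist_triangle4 y x 0 u, dist_comm u 0]
  rw [if_pos h1]
  exact ENNReal.ofReal_le_ofReal
    (pathLoss_anti (zero_le_two.trans p.two_lt_alpha.le) dist_nonneg h2)

lemma ae_userPos_mem (i : Fin M) : ∀ᵐ ω ∂P, net.userPos i ω ∈ Metric.closedBall 0 p.RD := by
  have h : P.map (net.userPos i) = cond volume (Metric.closedBall 0 p.RD) := net.userPos_uniform i
  refine ae_of_ae_map (net.measurable_userPos i).aemeasurable ?_
  rw [h]
  exact ae_cond_mem measurableSet_closedBall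

lemma measure_small_fading_inter_hits_pos [IsProbabilityMeasure P] {r : ℝ} (hr : 0 < r)
    (x : Plane) :
    0 < P ({ω | ∀ i, net.userFading i ω ∈ Metric.ball 0 r} ∩
      {ω | ∃ n, net.ptPos n ω ∈ Metric.ball x 1}) := by
  classical
  -- Only the user fadings and the transmitter process are constrained, so independence is applied
  -- to a finite set of sources.
  set f : Source M → Set Ω := fun s => match s with
    | .userFading i => net.userFading i ⁻¹' Metric.ball 0 r
    | .ptPoints => {ω | ∃ n, net.ptPos n ω ∈ Metric.ball x 1}
    | _ => Set.univ with hf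
  set S : Finset (Source M) := insert .ptPoints (Finset.univ.image .userFading) with hS
  have hpos : ∀ s ∈ S, 0 < P (f s) := by
    intro s hs
    simp only [hS, Finset.mem_insert, Finset.mem_image, Finset.mem_univ, true_and] at hs
    obtain rfl | ⟨i, rfl⟩ := hs
    · exact net.ptPos_poisson.measure_hits_pos p.lamB_pos x one_pos
    · have := stdComplexGaussian_ball_pos hr
      rwa [← net.userFading_law i,
        Measure.map_apply (net.measurable_userFading i) measurableSet_ball] at this
  have hind := net.independent.meas_biInter (S := S) (s := f) ?_
  · have hset : ⋂ s ∈ S, f s = {ω | ∀ i, net.userFading i ω ∈ Metric.ball 0 r} ∩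
        {ω | ∃ n, net.ptPos n ω ∈ Metric.ball x 1} := by
      ext ω
      simp [hS, hf, and_comm]
    rw [← hset, hind]
    exact (Finset.prod_ne_zero_iff.2 fun s hs => (hpos s hs).ne').bot_lt
  · intro s hs
    simp only [hS, Finset.mem_insert, Finset.mem_image, Finset.mem_univ, true_and] at hs
    obtain rfl | ⟨i, rfl⟩ := hs
    · refine ⟨{y : ℕ → Plane | ∃ n, y n ∈ Metric.ball x 1}, ?_, rfl⟩
      rw [Set.ofPred_exists]
      exact .iUnion fun n => measurable_pi_apply n measurableSet_ball
    · exact ⟨Metric.ball 0 r, measurableSet_ball, rfl⟩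

lemma errorFloor_pos [IsProbabilityMeasure P] {ν : ℝ} (κ : ℝ) (hν : 0 < ν) {m : Fin M}
    (hm : ∀ j ≤ m, 0 < p.a j - p.tau j * p.tailPower j) : 0 < net.errorFloor ν κ m := by
  have hε := p.epsMax_pos hm
  have hRD := p.RD_pos
  have hd0 := zero_lt_one.trans_le p.one_le_d0
  set c := pathLoss p.alpha (2 * p.RD + p.d0 + 2) with hc
  have hc0 : 0 < c := pathLoss_pos _ (by positivity)
  -- With `c` a lower bound for the interference, this is the level below which the gain must stay.
  -- Since `γ ≤ 1`, the primary receivers play no role.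
  have hη : 0 < ν * p.epsMax m * c := by positivity
  set x : Plane := EuclideanSpace.single 0 (p.RD + p.d0 + 1)
  have hx : ‖x‖ = p.RD + p.d0 + 1 := by
    rw [PiLp.norm_single, Real.norm_of_nonneg (by positivity)]
  have hE := net.measure_small_fading_inter_hits_pos (Real.sqrt_pos.2 hη) x
  refine ENNReal.toReal_pos (hE.trans_le (measure_mono_ae ?_)).ne' (measure_ne_top _ _)
  filter_upwards [ae_all_iff.2 net.ae_userPos_mem] with ω hpos
  rintro ⟨hfad, n, hn⟩
  have hgain := net.gain_le (η := ν * p.epsMax m * c) (fun i => by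
    have := mem_ball_zero_iff.1 (hfad i)
    exact ((Real.lt_sqrt (norm_nonneg _)).1 this).le) m
  calc net.gain m ω * net.gammaT 1 κ ω ≤ net.gain m ω * 1 := by
        gcongr
        exact (min_le_right _ _).trans_eq ENNReal.ofReal_one
    _ ≤ ENNReal.ofReal (ν * p.epsMax m * c) := by rwa [mul_one]
    _ = ENNReal.ofReal (ν * p.epsMax m) * ENNReal.ofReal c := ENNReal.ofReal_mul (by positivity)
    _ ≤ _ := by
        gcongr
        exact net.le_interference hpos hx hn m

end Network

/-! ### The closed-form expression -/

namespace Params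

variable {M : ℕ} (p : Params M)

/-- `aL` is homogeneous of degree `-δ`. -/
lemma aL_scale {κ ρ : ℝ} (hκ : 0 < κ) (hρ : 0 < ρ) : p.aL (κ * ρ) * ρ ^ p.delta = p.aL κ := by
  unfold aL
  rw [Real.mul_rpow hκ.le hρ.le]
  have := Real.rpow_pos_of_pos hκ p.delta
  have := Real.rpow_pos_of_pos hρ p.delta
  field_simp

lemma eta_scale (K k : ℕ) {κ ρ : ℝ} (hκ : 0 < κ) (hρ : 0 < ρ) :
    p.eta K k ρ (κ * ρ) = p.etaInf K k κ := by
  unfold eta etaInf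
  rw [aL_scale p hκ hρ, mul_assoc _ (p.aL _) (ρ ^ p.delta), aL_scale p hκ hρ, mul_comm κ ρ,
    mul_div_mul_left _ _ hρ.ne']

lemma tendsto_orderedSum (N : ℕ) (m : Fin M) {ι : Type*} {l : Filter ι} {G : ι → ℝ → ℝ}
    {G' : ℝ → ℝ} (h : ∀ S, Tendsto (fun x => G x S) l (𝓝 (G' S))) :
    Tendsto (fun x => p.orderedSum N m (G x)) l (𝓝 (p.orderedSum N m G')) :=
  (tendsto_finsetSum _ fun _ _ => (tendsto_finsetSum _ fun _ _ =>
    (h _).const_mul _).const_mul _).const_mul _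

lemma tendsto_outageClosed (N K L : ℕ) (ν : ℝ) {κ : ℝ} (hκ : 0 < κ) (m : Fin M) :
    Tendsto (fun ρ : ℝ => p.outageClosed N K L ρ (ν * ρ) (κ * ρ) m) atTop
      (𝓝 (p.floorClosed N K L ν κ m)) := by
  refine p.tendsto_orderedSum N m fun S => ?_
  have hdiv (y : ℝ) : Tendsto (fun ρ : ℝ => y / ρ) atTop (𝓝 0) :=
    tendsto_const_nhds.div_atTop tendsto_id
  refine .add ?_ (tendsto_finsetSum _ fun k _ => ?_)
  · have h := (((hdiv (p.epsMax m * S)).const_sub (-(p.aL κ * Real.exp (-κ)))).sub_const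
      (p.lapExponent L (ν * p.epsMax m * S))).rexp
    rw [sub_zero] at h
    refine h.congr' ?_
    filter_upwards [eventually_gt_atTop 0] with ρ hρ
    have h2 : ν * ρ * p.epsMax m * S / ρ = ν * p.epsMax m * S := by field_simp
    rw [aL_scale p hκ hρ, mul_div_cancel_right₀ _ hρ.ne', h2]
  · have h := ((((hdiv (p.epsMax m * S / unitNode K k)).const_add (κ / unitNode K k)).neg).sub_const
      (p.lapExponent L (ν * p.epsMax m * S / unitNode K k))).rexp.const_mul (p.etaInf K k κ)
    rw [add_zero] at h
    refine h.congr' ?_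
    filter_upwards [eventually_gt_atTop 0] with ρ hρ
    -- Only `ρ` is cancelled, so the nodes need not be shown nonzero.
    have h1 : (κ * ρ + p.epsMax m * S) / (ρ * unitNode K k) =
        κ / unitNode K k + p.epsMax m * S / unitNode K k / ρ := by
      rw [add_div, mul_comm κ ρ, mul_div_mul_left _ _ hρ.ne', div_div, mul_comm ρ]
    have h2 : ν * ρ * p.epsMax m * S / (ρ * unitNode K k) =
        ν * p.epsMax m * S / unitNode K k := by
      rw [← mul_div_mul_left _ (unitNode K k) hρ.ne']
      ring
    rw [eta_scale p K k hκ hρ, h1, h2]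

end Params

/-- The numerator converges to `log c` while `log ρ` diverges. -/
lemma tendsto_neg_log_div_log {f : ℝ → ℝ} {c : ℝ} (hc : 0 < c) (hf : Tendsto f atTop (𝓝 c)) :
    Tendsto (fun ρ => -(Real.log (f ρ) / Real.log ρ)) atTop (𝓝 0) := by
  simpa using ((hf.log hc.ne').div_atTop Real.tendsto_log_atTop).neg

end CRNoma

theorem mainTheorem3 {M : ℕ} (p : CRNoma.Params M) {Ω : Type*} [MeasurableSpace Ω]
    (P : Measure Ω) [IsProbabilityMeasure P] (net : CRNoma.Network p P)
    (ν κ : ℝ) (hν : 0 < ν) (hκ : 0 < κ) (m : Fin M)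
    (hm : ∀ j ≤ m, 0 < p.a j - p.tau j * p.tailPower j) :
    (∀ ρ : ℝ, 0 < ρ → net.outageProb ρ (ν * ρ) (κ * ρ) m =
      P.real {ω | net.X ρ (ν * ρ) (κ * ρ) m ω < ENNReal.ofReal (p.epsMax m)}) ∧
    0 < net.errorFloor ν κ m ∧
    Tendsto (fun ρ : ℝ => net.outageProb ρ (ν * ρ) (κ * ρ) m) atTop
      (𝓝 (net.errorFloor ν κ m)) ∧
    Tendsto (fun ρ : ℝ => -(Real.log (net.outageProb ρ (ν * ρ) (κ * ρ) m) / Real.log ρ)) atTop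
      (𝓝 0) ∧
    ∀ N K L : ℕ, 0 < N → 0 < K → 0 < L →
      Tendsto (fun ρ : ℝ => p.outageClosed N K L ρ (ν * ρ) (κ * ρ) m) atTop
        (𝓝 (p.floorClosed N K L ν κ m)) ∧
      (0 < p.floorClosed N K L ν κ m →
        Tendsto (fun ρ : ℝ => -(Real.log (p.outageClosed N K L ρ (ν * ρ) (κ * ρ) m) /
          Real.log ρ)) atTop (𝓝 0)) :=
  have hpos := net.errorFloor_pos κ hν hm
  have hlim := net.tendsto_outageProb ν κ hm
  ⟨fun _ _ => net.outageProb_eq _ _ _ hm, hpos, hlim, CRNoma.tendsto_neg_log_div_log hpos hlim,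
    fun N K L _ _ _ => ⟨p.tendsto_outageClosed N K L ν hκ m, fun hfloor =>
      CRNoma.tendsto_neg_log_div_log hfloor (p.tendsto_outageClosed N K L ν hκ m)⟩⟩
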